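/- Let $k$ be a field, let $K/k$ be a separable extension of degree $4$ with Galois closure $\widetilde K$, and suppose that $\mathrm{Gal}(\widetilde K/k)\simeq S_4$. Let $F$ be a field with $K\subseteq F\subseteq \widetilde K$. Then $F/k$ is Hopf Galois, i.e. there are a finite cocommutative $k$-Hopf algebra $H$ and an $H$-module algebra structure on $F$ such that the $k$-linear map $j: F\otimes_k H\to \mathrm{End}_k(F)$, $j(s\otimes h)(t)=s\,(h\cdot t)$, is bijective. Moreover $\widetilde K$ is a Galois closure of $F/k$. Put $G=\mathrm{Gal}(\widetilde K/k)$, $G''=\mathrm{Gal}(\widetilde K/F)$, and let $\lambda:G\to\mathrm{Sym}(G/G'')$ be the action by left translation on left cosets. The extension $F/k$ is called almost classically Galois if there is a regular subgroup $N$ of $\mathrm{Sym}(G/G'')$ that is normalized by $\lambda(G)$ and contained in $\lambda(G)$. (a) If $[F:k]=12$, then $F/k$ is almost classically Galois. (b) If $[F:k]=8$, then $F/k$ is not almost classically Galois, and it has a Hopf Galois structure that comes from a group $N\simeq C_2\times C_2\times C_2$: there are a regular subgroup $N\simeq C_2^3$ of $\mathrm{Sym}(G/G'')$ normalized by $\lambda(G)$,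 a finite cocommutative $k$-Hopf algebra $H$ acting on $F$ as above (with $j$ bijective), and an isomorphism $\Phi:\widetilde K\otimes_k H\to\widetilde K[N]$ of $\widetilde K$-Hopf algebras such that, whenever $h\in H$ and $\Phi(1\otimes h)=\sum_{n\in N} c_n n$, one has $(h\cdot x)(q)=\sum_{n\in N} c_n\, x(n^{-1}q)$ for all $x\in F$ and $q\in G/G''$, where $y(gG'')$ denotes $g(y)$ for $y\in F$, $g\in G$. -/

import Mathlib

open scoped TensorProduct

universe u v w

namespace HopfGalois

section HopfAction

variable {k : Type u} [Field k] {A : Type v} [CommRing A] [Algebra k A]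
  {H : Type w} [Ring H] [HopfAlgebra k H]

/-- The action `μ : H → End_k(A)` makes the `k`-algebra `A` an `H`-module algebra:
`h · 1 = ε(h) 1` and `h · (s t) = ∑ (h₁ · s) (h₂ · t)`, where `Δ h = ∑ h₁ ⊗ h₂`. -/
structure IsModuleAlgebra (μ : H →ₐ[k] Module.End k A) : Prop where
  apply_one : ∀ h : H, μ h 1 = algebraMap k A (Coalgebra.counit h)
  apply_mul : ∀ (h : H) (s t : A),
    μ h (s * t) = LinearMap.mul' k A
      (TensorProduct.map (μ.toLinearMap.flip s) (μ.toLinearMap.flip t) (Coalgebra.comul h))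

/-- The `k`-linear map `j : A ⊗ H → End_k(A)`, `j (s ⊗ h) (t) = s (h · t)`. -/
noncomputable def galoisMap (μ : H →ₐ[k] Module.End k A) : A ⊗[k] H →ₗ[k] Module.End k A :=
  TensorProduct.lift
    ((LinearMap.mul k (Module.End k A)).compl₁₂ (Algebra.lmul k A).toLinearMap μ.toLinearMap)

theorem galoisMap_tmul (μ : H →ₐ[k] Module.End k A) (s : A) (h : H) (t : A) :
    galoisMap μ (s ⊗ₜ[k] h) t = s * μ h t := by
  simp [galoisMap]

/-- `H` is a finite cocommutative `k`-Hopf algebra, `A` is an `H`-module algebra through `μ`, and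
`j : A ⊗ H → End_k(A)` is bijective. -/
structure IsHopfGaloisAction (μ : H →ₐ[k] Module.End k A) : Prop where
  finite : Module.Finite k H
  cocomm : Coalgebra.IsCocomm k H
  moduleAlgebra : IsModuleAlgebra μ
  bijective : Function.Bijective (galoisMap μ)

end HopfAction

/-- The finite field extension `F / k` is Hopf Galois. (As `H` is finite-dimensional over `k` and
`k` embeds in `F`, taking `H` in the universe of `F` is no restriction.) -/
def IsHopfGalois (k : Type u) [Field k] (F : Type v) [Field F] [Algebra k F] : Prop :=
  ∃ (H : Type v) (_ : Ring H) (_ : HopfAlgebra k H) (μ : H →ₐ[k] Module.End k F),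
    IsHopfGaloisAction μ

/-- A group `N` of permutations of `X` is regular: it acts simply transitively. -/
def IsRegular {X : Type v} (N : Subgroup (Equiv.Perm X)) : Prop :=
  ∀ x y : X, ∃! n : Equiv.Perm X, n ∈ N ∧ n x = y

section GaloisClosure

variable {k : Type u} [Field k] {L : Type v} [Field L] [Algebra k L]

/-- The set `G / G'` of left cosets, where `G = Gal(L/k)` and `G' = Gal(L/F)`. -/
abbrev Cosets (F : IntermediateField k L) : Type v := (L ≃ₐ[k] L) ⧸ F.fixingSubgroup

/-- The subgroup `λ(G)` of `Sym(G / G')`, where `λ` is the action of `G` on `G / G'` by left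
translation. -/
def translations (F : IntermediateField k L) : Subgroup (Equiv.Perm (Cosets F)) :=
  (MulAction.toPermHom (L ≃ₐ[k] L) (Cosets F)).range

/-- The separable extension `F / k`, with Galois closure `L`, is almost classically Galois: some
regular subgroup of `Sym(G / G')` is normalized by `λ(G)` and contained in `λ(G)`. -/
def IsAlmostClassicallyGalois (F : IntermediateField k L) [IsNormalClosure k F L] : Prop :=
  ∃ N : Subgroup (Equiv.Perm (Cosets F)),
    IsRegular N ∧ translations F ≤ Subgroup.normalizer N ∧ N ≤ translations F

/-- The value `g x` of the coset `g G'` at an element `x` of `F`. -/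
def cosetApply (F : IntermediateField k L) (q : Cosets F) (x : F) : L :=
  Quotient.liftOn' q (fun g : L ≃ₐ[k] L => g x) fun a b hab => by
    have h := (IntermediateField.mem_fixingSubgroup_iff F (a⁻¹ * b)).1
      (QuotientGroup.leftRel_apply.1 hab) x x.2
    have h' := congrArg a h
    simpa [AlgEquiv.mul_apply, ← AlgEquiv.aut_inv] using h'.symm

/-- The action `μ` of the Hopf algebra `H` on `F` comes from the group `N` of permutations of
`G / G'`: there is an isomorphism `Φ : L ⊗ H ≃ L[N]` of Hopf algebras over `L` under which `H` acts
on `F`, embedded in `Map(G / G', L)` by `x ↦ (g G' ↦ g x)`, through the permutation action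
`(n f)(q) = f (n⁻¹ q)` of `N` on `Map(G / G', L)`. -/
def ComesFrom (F : IntermediateField k L) [IsNormalClosure k F L]
    (N : Subgroup (Equiv.Perm (Cosets F)))
    {H : Type w} [Ring H] [HopfAlgebra k H] (μ : H →ₐ[k] Module.End k F) : Prop :=
  ∃ Φ : L ⊗[k] H ≃ₐc[L] MonoidAlgebra L N, ∀ (h : H) (x : F) (q : Cosets F),
    cosetApply F q (μ h x) =
      ((Φ (1 ⊗ₜ[k] h)).coeff).sum fun n c => c * cosetApply F ((n⁻¹ : N).1 q) x

end GaloisClosure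

end HopfGalois

/-!
A regular group `N` of permutations of `G / G'`, normalized by the left translations, gives a Hopf
Galois structure by Galois descent. The group `G = Gal(L/k)` acts on `L[N]` through the scalars and
by conjugation on `N`, and `H = L[N]^G` satisfies `L ⊗ H ≃ L[N]` (`isBaseChange_invariants`). A
`k`-subspace whose base change is `L[N]` embeds in `L[N]`, and so do its tensor powers over `k` in
those of `L[N]` over `L`; hence every Hopf algebra axiom for `H` can be checked in `L[N]`
(`HopfForm.hopfAlgebra`, `exists_hopfForm_fixedAlgebra`). The field `F` is the algebra of equivariant
maps `G / G' → L`, on which `H` acts through the permutation action of `L[N]`. The map `j` is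
injective by Dedekind's theorem on the independence of the embeddings `F → L`, and it is bijective
because both sides have dimension `[F : k] ^ 2` (`exists_isHopfGaloisAction`).

What remains is to find `N`. If `M` is a normal subgroup of `G` with complement `C`, and `B ≤ C` is
normal in `C`, the permutations `a B ↦ m a c B` of `G / B` form a regular group, isomorphic to
`M × C / B` and normalized by `G` (`isRegular_biTranslations`). The faithful action of `G` on the
four cosets of `Gal(L/K)` identifies `G` with `S₄` and `Gal(L/K)` with the stabilizer of a letter,
which contains `B = Gal(L/F)`. If `B` has order `2`, it is generated by a transposition: `M = A₄` and
`C = B` give a regular group of left translations. Otherwise `B` is normal in the stabilizer, and `M`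
is taken to be the Klein four-group and `C` the stabilizer; when `B` has order `3` the result is
`C₂ × C₂ × C₂`. In that case no regular subgroup of the left translations is normalized by them,
since `S₄` has no normal subgroup of order `8` (`card_ne_eight_of_normal`).
-/

namespace HopfGalois

/-! ### Galois descent for vector spaces -/

section Descent

variable {k L V : Type*} [Field k] [Field L] [Algebra k L] [AddCommGroup V] [Module k V]
  [Module L V] [IsScalarTower k L V]

/-- The `k`-subspace of vectors fixed by a semilinear action. -/
def invariants (ρ : (L ≃ₐ[k] L) →* (V →ₗ[k] V)) : Submodule k V where
  carrier := {v | ∀ g, ρ g v = v}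
  add_mem' ha hb g := by rw [map_add, ha g, hb g]
  zero_mem' g := map_zero _
  smul_mem' c v hv g := by rw [map_smul, hv g]

variable [FiniteDimensional k L]

omit [IsScalarTower k L V] in
/-- Averaging `m • v` over the group gives invariant vectors; a functional vanishing on all of
them vanishes on `v` by linear independence of the automorphisms of `L`. -/
theorem span_invariants_eq_top (ρ : (L ≃ₐ[k] L) →* (V →ₗ[k] V))
    (hρ : ∀ g (c : L) v, ρ g (c • v) = g c • ρ g v) :
    Submodule.span L (invariants ρ : Set V) = ⊤ := by
  by_contra hne
  obtain ⟨φ, hφ, hle⟩ := Submodule.exists_le_ker_of_lt_top _ (lt_top_iff_ne_top.2 hne)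
  apply hφ
  ext v
  have hinv : ∀ m : L, ∑ g : L ≃ₐ[k] L, φ (ρ g v) * g m = 0 := by
    intro m
    have hmem : ∑ g : L ≃ₐ[k] L, ρ g (m • v) ∈ invariants ρ := by
      intro h
      rw [map_sum]
      exact Fintype.sum_equiv (Equiv.mulLeft h) _ _ fun g => by simp [map_mul]
    have := hle (Submodule.subset_span hmem)
    rw [LinearMap.mem_ker, map_sum] at this
    simpa [hρ, mul_comm] using this
  have hind := (linearIndependent_monoidHom L L).comp
    (fun g : L ≃ₐ[k] L => ((g : L →+* L) : L →* L))
    (fun g h hgh => AlgEquiv.ext fun x => DFunLike.congr_fun hgh x)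
  have := Fintype.linearIndependent_iff.1 hind (fun g => φ (ρ g v)) (by
    funext m
    simpa using hinv m) 1
  simpa using this

omit [IsScalarTower k L V] [FiniteDimensional k L] in
/-- In a basis of invariant vectors, the semilinear action is the action on coordinates. -/
theorem repr_apply_of_invariant (ρ : (L ≃ₐ[k] L) →* (V →ₗ[k] V))
    (hρ : ∀ g (c : L) v, ρ g (c • v) = g c • ρ g v) {ι : Type*} (b : Module.Basis ι L V)
    (hb : ∀ i, b i ∈ invariants ρ) (g : L ≃ₐ[k] L) (v : V) (i : ι) :
    b.repr (ρ g v) i = g (b.repr v i) := by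
  have h1 : ρ g v = Finsupp.linearCombination L b ((b.repr v).mapRange g (map_zero g)) := by
    conv_lhs => rw [← b.linearCombination_repr v]
    rw [Finsupp.linearCombination_apply, Finsupp.linearCombination_apply,
      Finsupp.sum_mapRange_index (by simp), Finsupp.sum, map_sum]
    exact Finset.sum_congr rfl fun i _ => by rw [hρ, hb i g]
  rw [h1, b.repr_linearCombination, Finsupp.mapRange_apply]

/-- Galois descent: `V` is the base change of its space of invariants. A basis of `V` extracted from
the spanning set of invariants is also a basis of the invariants over `k`, since the coordinates of
an invariant vector are invariant. -/
theorem isBaseChange_invariants [IsGalois k L] (ρ : (L ≃ₐ[k] L) →* (V →ₗ[k] V))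
    (hρ : ∀ g (c : L) v, ρ g (c • v) = g c • ρ g v) :
    IsBaseChange L (invariants ρ).subtype := by
  have hspan := span_invariants_eq_top ρ hρ
  let b := Module.Basis.ofSpan hspan.ge
  have hb : ∀ i, b i ∈ invariants ρ := fun i =>
    Module.Basis.ofSpan_subset hspan.ge ⟨i, rfl⟩
  have hli : LinearIndependent k (fun i => (⟨b i, hb i⟩ : invariants ρ)) := by
    apply LinearIndependent.of_comp (invariants ρ).subtype
    exact b.linearIndependent.restrict_scalars' k
  have hsp : ⊤ ≤ Submodule.span k (Set.range fun i => (⟨b i, hb i⟩ : invariants ρ)) := by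
    rintro ⟨v, hv⟩ -
    have hco : ∀ i, ∃ c : k, algebraMap k L c = b.repr v i := by
      intro i
      exact (IsGalois.mem_bot_iff_fixed (F := k) (b.repr v i)).2 fun g => by
        rw [← repr_apply_of_invariant ρ hρ b hb, hv g]
    choose c hc using hco
    have : (⟨v, hv⟩ : invariants ρ) = ∑ i ∈ (b.repr v).support, c i • ⟨b i, hb i⟩ := by
      apply Subtype.ext
      refine (b.linearCombination_repr v).symm.trans ?_
      rw [Finsupp.linearCombination_apply, Finsupp.sum]
      simp [← hc, algebraMap_smul]
    rw [this]
    exact Submodule.sum_mem _ fun i _ => Submodule.smul_mem _ _ (Submodule.subset_span ⟨i, rfl⟩)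
  let b₀ := Module.Basis.mk hli hsp
  refine IsBaseChange.of_equiv ((b₀.baseChange L).equiv b (Equiv.refl _)) fun x => ?_
  have : (((b₀.baseChange L).equiv b (Equiv.refl _)).toLinearMap.restrictScalars k) ∘ₗ
      TensorProduct.mk k L _ 1 = (invariants ρ).subtype := by
    refine b₀.ext fun i => ?_
    have := (b₀.baseChange L).equiv_apply i b (Equiv.refl _)
    simpa [b₀] using this
  exact LinearMap.congr_fun this x

end Descent

/-! ### Base change and tensor products -/

section Tensor

variable {k L : Type*} [Field k] [Field L] [Algebra k L]
  {M M' W W' : Type*} [AddCommGroup M] [Module k M] [AddCommGroup M'] [Module k M']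
  [AddCommGroup W] [Module k W] [Module L W] [IsScalarTower k L W]
  [AddCommGroup W'] [Module k W'] [Module L W'] [IsScalarTower k L W']

variable (L) in
/-- The map `M ⊗ₖ M' → W ⊗_L W'` induced by `k`-linear maps `M → W` and `M' → W'`. -/
noncomputable def tensorForm (f : M →ₗ[k] W) (g : M' →ₗ[k] W') : M ⊗[k] M' →ₗ[k] W ⊗[L] W' :=
  (TensorProduct.mapOfCompatibleSMul L k k W W') ∘ₗ TensorProduct.map f g

@[simp]
theorem tensorForm_tmul (f : M →ₗ[k] W) (g : M' →ₗ[k] W') (x : M) (y : M') :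
    tensorForm L f g (x ⊗ₜ y) = f x ⊗ₜ g y := rfl

/-- The tensor product of base changes is a base change: `L ⊗ (M ⊗ M') ≃ (L ⊗ M) ⊗_L (L ⊗ M')`. -/
theorem isBaseChange_tensorForm {f : M →ₗ[k] W} {g : M' →ₗ[k] W'} (hf : IsBaseChange L f)
    (hg : IsBaseChange L g) : IsBaseChange L (tensorForm L f g) := by
  refine IsBaseChange.of_equiv ((TensorProduct.AlgebraTensorModule.distribBaseChange k L M M').trans
    (TensorProduct.congr hf.equiv hg.equiv)) fun x => ?_
  induction x with
  | zero => simp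
  | add x y hx hy => rw [TensorProduct.tmul_add, map_add, hx, hy, map_add]
  | tmul x y => simp

/-- A vector space embeds in its base change, as field extensions are faithfully flat. -/
theorem injective_of_isBaseChange {f : M →ₗ[k] W} (hf : IsBaseChange L f) :
    Function.Injective f := by
  have h : ⇑f = hf.equiv ∘ (TensorProduct.mk k L M 1) := by
    funext x; simp
  rw [h]
  exact hf.equiv.injective.comp (Module.FaithfullyFlat.tensorProduct_mk_injective (B := L) M)

end Tensor

/-! ### Forms of Hopf algebras -/

section HopfForm

variable {k L H W : Type*} [Field k] [Field L] [Algebra k L] [Ring H] [Algebra k H]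
  [Ring W] [HopfAlgebra L W] [Algebra k W] [IsScalarTower k L W]

variable (L) in
/-- A `k`-form `ι : H → W` of the `L`-Hopf algebra `W`: a `k`-algebra `H` whose base change to `L`
is `W`, with `k`-linear maps that `ι` carries to the comultiplication, the counit and the antipode
of `W`. No Hopf algebra axiom is required of `H`; they all follow from those of `W`. -/
structure HopfForm (ι : H →ₐ[k] W) where
  /-- The map inducing the comultiplication of `W`. -/
  comul : H →ₗ[k] H ⊗[k] H
  /-- The map inducing the counit of `W`. -/
  counit : H →ₗ[k] k
  /-- The map inducing the antipode of `W`. -/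
  antipode : H →ₗ[k] H
  isBaseChange : IsBaseChange L ι.toLinearMap
  map_comul : ∀ h, tensorForm L ι.toLinearMap ι.toLinearMap (comul h) =
    Coalgebra.comul (R := L) (ι h)
  map_counit : ∀ h, algebraMap k L (counit h) = Coalgebra.counit (R := L) (ι h)
  map_antipode : ∀ h, ι (antipode h) = HopfAlgebra.antipode L (ι h)

namespace HopfForm

variable {ι : H →ₐ[k] W} (D : HopfForm L ι)

include D

theorem injective : Function.Injective ι :=
  injective_of_isBaseChange D.isBaseChange

theorem tensor_injective :
    Function.Injective (tensorForm L ι.toLinearMap ι.toLinearMap) :=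
  injective_of_isBaseChange (isBaseChange_tensorForm D.isBaseChange D.isBaseChange)

theorem tensor_tensor_injective :
    Function.Injective (tensorForm L ι.toLinearMap (tensorForm L ι.toLinearMap ι.toLinearMap)) :=
  injective_of_isBaseChange (isBaseChange_tensorForm D.isBaseChange
    (isBaseChange_tensorForm D.isBaseChange D.isBaseChange))

omit D in
theorem tensorForm_mul (x y : H ⊗[k] H) :
    tensorForm L ι.toLinearMap ι.toLinearMap (x * y) =
      tensorForm L ι.toLinearMap ι.toLinearMap x * tensorForm L ι.toLinearMap ι.toLinearMap y := by
  induction x with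
  | zero => simp
  | add x x' hx hx' => rw [add_mul, map_add, hx, hx', map_add, add_mul]
  | tmul a b =>
    induction y with
    | zero => simp
    | add y y' hy hy' => rw [mul_add, map_add, hy, hy', map_add, mul_add]
    | tmul c d => simp

omit D in
theorem tensor_assoc (x : H ⊗[k] H) (c : H) :
    tensorForm L ι.toLinearMap (tensorForm L ι.toLinearMap ι.toLinearMap)
      (TensorProduct.assoc k H H H (x ⊗ₜ c)) =
    TensorProduct.assoc L W W W (tensorForm L ι.toLinearMap ι.toLinearMap x ⊗ₜ ι c) := by
  induction x with
  | zero => simp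
  | add x x' hx hx' => simp only [TensorProduct.add_tmul, map_add, hx, hx']
  | tmul a b => simp

theorem map_assoc_rTensor (x : H ⊗[k] H) :
    tensorForm L ι.toLinearMap (tensorForm L ι.toLinearMap ι.toLinearMap)
      (TensorProduct.assoc k H H H (D.comul.rTensor H x)) =
    TensorProduct.assoc L W W W ((Coalgebra.comul (R := L) (A := W)).rTensor W
      (tensorForm L ι.toLinearMap ι.toLinearMap x)) := by
  induction x with
  | zero => simp
  | add x x' hx hx' => simp only [map_add, hx, hx']
  | tmul a b => simp [tensor_assoc, D.map_comul]

theorem map_lTensor (x : H ⊗[k] H) :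
    tensorForm L ι.toLinearMap (tensorForm L ι.toLinearMap ι.toLinearMap) (D.comul.lTensor H x) =
    (Coalgebra.comul (R := L) (A := W)).lTensor W
      (tensorForm L ι.toLinearMap ι.toLinearMap x) := by
  induction x with
  | zero => simp
  | add x x' hx hx' => simp only [map_add, hx, hx']
  | tmul a b => simp [D.map_comul]

theorem map_lid_rTensor (x : H ⊗[k] H) :
    ι (TensorProduct.lid k H (D.counit.rTensor H x)) =
    TensorProduct.lid L W ((Coalgebra.counit (R := L) (A := W)).rTensor W
      (tensorForm L ι.toLinearMap ι.toLinearMap x)) := by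
  induction x with
  | zero => simp
  | add x x' hx hx' => simp only [map_add, hx, hx']
  | tmul a b => simp [← D.map_counit]

theorem map_rid_lTensor (x : H ⊗[k] H) :
    ι (TensorProduct.rid k H (D.counit.lTensor H x)) =
    TensorProduct.rid L W ((Coalgebra.counit (R := L) (A := W)).lTensor W
      (tensorForm L ι.toLinearMap ι.toLinearMap x)) := by
  induction x with
  | zero => simp
  | add x x' hx hx' => simp only [map_add, hx, hx']
  | tmul a b => simp [← D.map_counit]

theorem map_mul_rTensor_antipode (x : H ⊗[k] H) :
    ι (LinearMap.mul' k H (D.antipode.rTensor H x)) =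
    LinearMap.mul' L W ((HopfAlgebra.antipode L (A := W)).rTensor W
      (tensorForm L ι.toLinearMap ι.toLinearMap x)) := by
  induction x with
  | zero => simp
  | add x x' hx hx' => simp only [map_add, hx, hx']
  | tmul a b => simp [D.map_antipode]

theorem map_mul_lTensor_antipode (x : H ⊗[k] H) :
    ι (LinearMap.mul' k H (D.antipode.lTensor H x)) =
    LinearMap.mul' L W ((HopfAlgebra.antipode L (A := W)).lTensor W
      (tensorForm L ι.toLinearMap ι.toLinearMap x)) := by
  induction x with
  | zero => simp
  | add x x' hx hx' => simp only [map_add, hx, hx']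
  | tmul a b => simp [D.map_antipode]

/-- The coalgebra structure on a form of a Hopf algebra. -/
abbrev coalgebra : Coalgebra k H where
  comul := D.comul
  counit := D.counit
  coassoc := LinearMap.ext fun h => D.tensor_tensor_injective <| by
    simp only [LinearMap.comp_apply, LinearEquiv.coe_coe]
    rw [D.map_assoc_rTensor, D.map_lTensor, D.map_comul, Coalgebra.coassoc_apply]
  rTensor_counit_comp_comul := LinearMap.ext fun h => (TensorProduct.lid k H).injective <|
      D.injective <| by
    simp only [LinearMap.comp_apply]
    rw [D.map_lid_rTensor, D.map_comul, Coalgebra.rTensor_counit_comul]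
    simp
  lTensor_counit_comp_comul := LinearMap.ext fun h => (TensorProduct.rid k H).injective <|
      D.injective <| by
    simp only [LinearMap.comp_apply]
    rw [D.map_rid_lTensor, D.map_comul, Coalgebra.lTensor_counit_comul]
    simp

/-- The bialgebra structure on a form of a Hopf algebra. -/
abbrev bialgebra : Bialgebra k H :=
  letI := D.coalgebra
  Bialgebra.mk' k H
    ((algebraMap k L).injective <| by
      change algebraMap k L (D.counit 1) = _
      rw [D.map_counit, map_one, Bialgebra.counit_one, map_one])
    (fun {a b} => (algebraMap k L).injective <| by
      change algebraMap k L (D.counit (a * b)) = algebraMap k L (D.counit a * D.counit b)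
      rw [map_mul (algebraMap k L), D.map_counit, D.map_counit, D.map_counit, map_mul,
        Bialgebra.counit_mul])
    (D.tensor_injective <| by
      change tensorForm L ι.toLinearMap ι.toLinearMap (D.comul 1) = _
      rw [D.map_comul, map_one, Bialgebra.comul_one]
      simp [Algebra.TensorProduct.one_def])
    (fun {a b} => D.tensor_injective <| by
      change tensorForm L ι.toLinearMap ι.toLinearMap (D.comul (a * b)) =
        tensorForm L ι.toLinearMap ι.toLinearMap (D.comul a * D.comul b)
      rw [tensorForm_mul, D.map_comul, D.map_comul, D.map_comul, map_mul, Bialgebra.comul_mul])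

/-- The Hopf algebra structure on a form of a Hopf algebra. -/
abbrev hopfAlgebra : HopfAlgebra k H :=
  { D.bialgebra with
    antipode := D.antipode
    mul_antipode_rTensor_comul := LinearMap.ext fun h => D.injective <| by
      change ι (LinearMap.mul' k H (D.antipode.rTensor H (D.comul h))) =
        ι (algebraMap k H (D.counit h))
      rw [D.map_mul_rTensor_antipode, D.map_comul, HopfAlgebra.mul_antipode_rTensor_comul_apply,
        AlgHom.commutes, IsScalarTower.algebraMap_apply k L W, D.map_counit]
    mul_antipode_lTensor_comul := LinearMap.ext fun h => D.injective <| by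
      change ι (LinearMap.mul' k H (D.antipode.lTensor H (D.comul h))) =
        ι (algebraMap k H (D.counit h))
      rw [D.map_mul_lTensor_antipode, D.map_comul, HopfAlgebra.mul_antipode_lTensor_comul_apply,
        AlgHom.commutes, IsScalarTower.algebraMap_apply k L W, D.map_counit] }

theorem isCocomm [Coalgebra.IsCocomm L W] :
    letI := D.hopfAlgebra
    Coalgebra.IsCocomm k H := by
  let := D.hopfAlgebra
  refine ⟨LinearMap.ext fun h => D.tensor_injective ?_⟩
  have key : ∀ x : H ⊗[k] H, tensorForm L ι.toLinearMap ι.toLinearMap (TensorProduct.comm k H H x) =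
      TensorProduct.comm L W W (tensorForm L ι.toLinearMap ι.toLinearMap x) := by
    intro x
    induction x with
    | zero => simp
    | add x x' hx hx' => simp only [map_add, hx, hx']
    | tmul a b => simp
  change tensorForm L ι.toLinearMap ι.toLinearMap (TensorProduct.comm k H H (D.comul h)) =
    tensorForm L ι.toLinearMap ι.toLinearMap (D.comul h)
  rw [key, D.map_comul, Coalgebra.comm_comul]

omit D [Algebra k L] [IsScalarTower k L W] in
theorem commute_ofId (c : L) (h : H) : Commute (Algebra.ofId L W c) (ι h) :=
  Algebra.commutes c (ι h)

/-- The algebra isomorphism `L ⊗ H ≃ W` attached to a form `H` of `W`. -/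
noncomputable def algEquiv : L ⊗[k] H ≃ₐ[L] W :=
  AlgEquiv.ofBijective
    (Algebra.TensorProduct.lift (Algebra.ofId L W) ι commute_ofId) <| by
    have : ⇑(Algebra.TensorProduct.lift (Algebra.ofId L W) ι
        commute_ofId) = D.isBaseChange.equiv := by
      funext x
      induction x with
      | zero => simp
      | add x y hx hy => rw [map_add, map_add, hx, hy]
      | tmul c h =>
        rw [Algebra.TensorProduct.lift_tmul, Algebra.ofId_apply, IsBaseChange.equiv_tmul,
          Algebra.smul_def]
        rfl
    rw [this]
    exact D.isBaseChange.equiv.bijective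

theorem algEquiv_tmul (c : L) (h : H) : D.algEquiv (c ⊗ₜ h) = c • ι h := by
  rw [Algebra.smul_def]
  exact Algebra.TensorProduct.lift_tmul (Algebra.ofId L W) ι commute_ofId c h

/-- The base change of a form `H` of `W` is isomorphic to `W` as a Hopf algebra. -/
noncomputable def bialgEquiv :
    letI := D.hopfAlgebra
    L ⊗[k] H ≃ₐc[L] W :=
  letI := D.hopfAlgebra
  BialgEquiv.ofAlgEquiv D.algEquiv
    (Algebra.TensorProduct.ext' fun c h => by
      have : Coalgebra.counit (R := k) h = D.counit h := rfl
      simp [algEquiv_tmul, ← D.map_counit, this, Algebra.smul_def, mul_comm])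
    (Algebra.TensorProduct.ext' fun c h => by
      have hc : Coalgebra.comul (R := k) h = D.comul h := rfl
      change Algebra.TensorProduct.map (D.algEquiv : L ⊗[k] H →ₐ[L] W)
          (D.algEquiv : L ⊗[k] H →ₐ[L] W) (Coalgebra.comul (R := L) (c ⊗ₜ[k] h)) =
        Coalgebra.comul (R := L) (D.algEquiv (c ⊗ₜ[k] h))
      rw [TensorProduct.comul_tmul, hc, algEquiv_tmul, map_smul, ← D.map_comul]
      induction D.comul h with
      | zero => simp
      | add x y hx hy => simp only [TensorProduct.tmul_add, map_add, hx, hy, smul_add]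
      | tmul a b => simp [algEquiv_tmul, TensorProduct.smul_tmul'])

theorem bialgEquiv_tmul (c : L) (h : H) :
    letI := D.hopfAlgebra
    D.bialgEquiv (c ⊗ₜ h) = c • ι h := D.algEquiv_tmul c h

end HopfForm

end HopfForm

section Lift

variable {R A B C : Type*} [Ring R] [AddCommGroup A] [AddCommGroup B] [AddCommGroup C]
  [Module R A] [Module R B] [Module R C]

/-- A linear map with values in the range of an injective linear map factors through it. -/
theorem exists_linearMap_comp_eq (i : A →ₗ[R] B) (hi : Function.Injective i) (f : C →ₗ[R] B)
    (hf : ∀ c, f c ∈ LinearMap.range i) : ∃ F : C →ₗ[R] A, ∀ c, i (F c) = f c :=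
  ⟨(LinearEquiv.ofInjective i hi).symm.toLinearMap ∘ₗ f.codRestrict _ hf, fun c =>
    congrArg Subtype.val ((LinearEquiv.ofInjective i hi).apply_symm_apply ⟨f c, hf c⟩)⟩

end Lift

/-! ### The fixed algebra of a group algebra -/

section Twist

variable {k L N : Type*} [Field k] [Field L] [Algebra k L] [Group N]

/-- The semilinear action of `Gal(L/k)` on `L[N]`, on the scalars and, through `c`, on `N`. -/
noncomputable def twist (c : (L ≃ₐ[k] L) →* MulAut N) (g : L ≃ₐ[k] L) :
    MonoidAlgebra L N →ₐ[k] MonoidAlgebra L N :=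
  (MonoidAlgebra.mapAlgHom N (g : L →ₐ[k] L)).comp
    (MonoidAlgebra.domCongr k L (c g) : MonoidAlgebra L N →ₐ[k] MonoidAlgebra L N)

variable (c : (L ≃ₐ[k] L) →* MulAut N)

@[simp]
theorem twist_single (g : L ≃ₐ[k] L) (n : N) (a : L) :
    twist c g (MonoidAlgebra.single n a) = MonoidAlgebra.single (c g n) (g a) := by
  simp [twist]

theorem twist_smul (g : L ≃ₐ[k] L) (a : L) (x : MonoidAlgebra L N) :
    twist c g (a • x) = g a • twist c g x := by
  induction x using MonoidAlgebra.induction_linear with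
  | zero => simp
  | add x y hx hy => simp only [smul_add, map_add, hx, hy]
  | single n b => simp

theorem coeff_twist (g : L ≃ₐ[k] L) (x : MonoidAlgebra L N) (n : N) :
    (twist c g x).coeff (c g n) = g (x.coeff n) := by
  simp [twist]

/-- The action `twist` as a homomorphism to the linear endomorphisms. -/
noncomputable def twistHom : (L ≃ₐ[k] L) →* (MonoidAlgebra L N →ₗ[k] MonoidAlgebra L N) where
  toFun g := (twist c g).toLinearMap
  map_one' := LinearMap.ext fun x => by
    induction x using MonoidAlgebra.induction_linear with
    | zero => simp
    | add x y hx hy => rw [map_add, hx, hy, map_add]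
    | single n b => simp
  map_mul' g h := LinearMap.ext fun x => by
    induction x using MonoidAlgebra.induction_linear with
    | zero => simp
    | add x y hx hy => rw [map_add, hx, hy, map_add]
    | single n b => simp

/-- The fixed algebra `L[N]^G`, where `G = Gal(L/k)` acts on `L` and, through `c`, on `N`. -/
noncomputable def fixedAlgebra : Subalgebra k (MonoidAlgebra L N) where
  carrier := {x | ∀ g, twist c g x = x}
  add_mem' ha hb g := by rw [map_add, ha g, hb g]
  mul_mem' ha hb g := by rw [map_mul, ha g, hb g]
  algebraMap_mem' r g := AlgHom.commutes _ _

variable {c} in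
theorem coeff_of_mem_fixedAlgebra {x : MonoidAlgebra L N} (hx : x ∈ fixedAlgebra c)
    (g : L ≃ₐ[k] L) (n : N) : x.coeff (c g n) = g (x.coeff n) := by
  conv_lhs => rw [← hx g]
  exact coeff_twist c g x n

theorem counit_twist (g : L ≃ₐ[k] L) (x : MonoidAlgebra L N) :
    Coalgebra.counit (R := L) (twist c g x) = g (Coalgebra.counit (R := L) x) := by
  induction x using MonoidAlgebra.induction_linear with
  | zero => simp
  | add x y hx hy => simp only [map_add, hx, hy]
  | single n b => simp

theorem antipode_twist (g : L ≃ₐ[k] L) (x : MonoidAlgebra L N) :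
    HopfAlgebra.antipode L (twist c g x) = twist c g (HopfAlgebra.antipode L x) := by
  induction x using MonoidAlgebra.induction_linear with
  | zero => simp
  | add x y hx hy => simp only [map_add, hx, hy]
  | single n b => simp

theorem comul_eq_sum [Fintype N] (x : MonoidAlgebra L N) :
    Coalgebra.comul (R := L) x = ∑ n, x.coeff n •
      (MonoidAlgebra.single n (1 : L) ⊗ₜ[L] MonoidAlgebra.single n (1 : L)) := by
  classical
  induction x using MonoidAlgebra.induction_linear with
  | zero => simp
  | add x y hx hy => simp [hx, hy, add_smul, Finset.sum_add_distrib]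
  | single n b =>
    have h : MonoidAlgebra.single n b = b • MonoidAlgebra.single n (1 : L) := by simp
    simp only [MonoidAlgebra.comul_single, MonoidAlgebra.coeff_single, Finsupp.single_apply,
      ite_smul, zero_smul, Finset.sum_ite_eq, Finset.mem_univ, if_true]
    rw [CommSemiring.comul_apply, TensorProduct.map_tmul, MonoidAlgebra.lsingle_apply,
      MonoidAlgebra.lsingle_apply, h, TensorProduct.tmul_smul]

variable [Finite N] [FiniteDimensional k L] [IsGalois k L]

omit [Finite N] in
theorem isBaseChange_fixedAlgebra : IsBaseChange L (fixedAlgebra c).val.toLinearMap :=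
  isBaseChange_invariants (twistHom c) (twist_smul c)

/-- In a basis `b` of `L[N]` consisting of invariants the coefficient of `bᵢ ⊗ bⱼ` in `Δ x` is
`∑ₙ x(n) bᵢ*(n) bⱼ*(n)`, which is Galois invariant when `x` is. -/
theorem comul_mem_range (x : fixedAlgebra c) :
    Coalgebra.comul (R := L) (x : MonoidAlgebra L N) ∈ LinearMap.range
      (tensorForm L (fixedAlgebra c).val.toLinearMap (fixedAlgebra c).val.toLinearMap) := by
  classical
  have := Fintype.ofFinite N
  let b₀ := Module.Basis.ofVectorSpace k (fixedAlgebra c)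
  let b := (isBaseChange_fixedAlgebra c).basis b₀
  have hb : ∀ i, b i = b₀ i := fun i => (isBaseChange_fixedAlgebra c).basis_apply b₀ i
  have hinv : ∀ i, b i ∈ invariants (twistHom c) := fun i => by
    rw [hb]; exact (b₀ i).2
  have : Module.Finite L (MonoidAlgebra L N) :=
    Module.Finite.equiv (MonoidAlgebra.coeffLinearEquiv L).symm
  have := Module.Basis.fintypeIndexOfRankLtAleph0 b (Module.rank_lt_aleph0 L _)
  let e : N → _ → L := fun n => b.repr (MonoidAlgebra.single n 1)
  have he : ∀ g n i, e (c g n) i = g (e n i) := fun g n i => by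
    have := repr_apply_of_invariant (twistHom c) (twist_smul c) b hinv g
      (MonoidAlgebra.single n 1) i
    rw [← this]
    simp [e, twistHom]
  have hco : ∀ i j, ∃ a : k, algebraMap k L a = ∑ n, x.1.coeff n * (e n i * e n j) := by
    intro i j
    refine (IsGalois.mem_bot_iff_fixed (F := k) (E := L) _).2 fun g => ?_
    rw [map_sum]
    exact Fintype.sum_equiv (c g).toEquiv _ _ fun n => by
      simp [he, coeff_of_mem_fixedAlgebra x.2]
  choose a ha using hco
  refine ⟨∑ i, ∑ j, a i j • (b₀ i ⊗ₜ b₀ j), ?_⟩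
  have hs : ∀ n, MonoidAlgebra.single n (1 : L) = ∑ i, e n i • b i := fun n =>
    (b.sum_repr _).symm
  have hterm : ∀ n, x.1.coeff n •
      (MonoidAlgebra.single n (1 : L) ⊗ₜ[L] MonoidAlgebra.single n (1 : L)) =
      ∑ i, ∑ j, (x.1.coeff n * (e n i * e n j)) • (b i ⊗ₜ[L] b j) := fun n => by
    simp_rw [hs n, TensorProduct.sum_tmul, TensorProduct.tmul_sum, TensorProduct.smul_tmul_smul,
      Finset.smul_sum, smul_smul]
  have hswap : ∀ f : N → Module.Basis.ofVectorSpaceIndex k (fixedAlgebra c) →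
      Module.Basis.ofVectorSpaceIndex k (fixedAlgebra c) → MonoidAlgebra L N ⊗[L] MonoidAlgebra L N,
      ∑ n, ∑ i, ∑ j, f n i j = ∑ i, ∑ j, ∑ n, f n i j := fun f => by
    rw [Finset.sum_comm]
    exact Finset.sum_congr rfl fun i _ => Finset.sum_comm
  rw [comul_eq_sum, Finset.sum_congr rfl fun n _ => hterm n, hswap]
  simp only [map_sum, map_smul, tensorForm_tmul, ← Finset.sum_smul, ← ha, algebraMap_smul, hb]
  rfl

/-- The fixed algebra is a form of the Hopf algebra `L[N]`: the comultiplication, the counit and the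
antipode of `L[N]` commute with the Galois action, so they restrict. -/
theorem exists_hopfForm_fixedAlgebra : Nonempty (HopfForm L (fixedAlgebra c).val) := by
  obtain ⟨Δ, hΔ⟩ := exists_linearMap_comp_eq
    (tensorForm L (fixedAlgebra c).val.toLinearMap (fixedAlgebra c).val.toLinearMap)
    (injective_of_isBaseChange (isBaseChange_tensorForm (isBaseChange_fixedAlgebra c)
      (isBaseChange_fixedAlgebra c)))
    (((Coalgebra.comul (R := L) (A := MonoidAlgebra L N)).restrictScalars k) ∘ₗ
      (fixedAlgebra c).val.toLinearMap) (comul_mem_range c)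
  obtain ⟨ε, hε⟩ := exists_linearMap_comp_eq (Algebra.linearMap k L) (algebraMap k L).injective
    (((Coalgebra.counit (R := L) (A := MonoidAlgebra L N)).restrictScalars k) ∘ₗ
      (fixedAlgebra c).val.toLinearMap) fun x =>
    (IsGalois.mem_bot_iff_fixed (F := k) (E := L) _).2 fun g => by
      change g (Coalgebra.counit (R := L) (x : MonoidAlgebra L N)) = Coalgebra.counit (R := L) x.1
      rw [← counit_twist c, x.2 g]
  obtain ⟨S, hS⟩ := exists_linearMap_comp_eq (fixedAlgebra c).val.toLinearMap
    Subtype.val_injective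
    (((HopfAlgebra.antipode L (A := MonoidAlgebra L N)).restrictScalars k) ∘ₗ
      (fixedAlgebra c).val.toLinearMap) fun x =>
    ⟨⟨HopfAlgebra.antipode L x.1, fun g => by rw [← antipode_twist, x.2 g]⟩, rfl⟩
  exact ⟨⟨Δ, ε, S, isBaseChange_fixedAlgebra c, hΔ, hε, hS⟩⟩

theorem finrank_fixedAlgebra : Module.finrank k (fixedAlgebra c) = Nat.card N := by
  have := Fintype.ofFinite N
  rw [← Module.finrank_baseChange (R := L), (isBaseChange_fixedAlgebra c).equiv.finrank_eq,
    (MonoidAlgebra.coeffLinearEquiv L).finrank_eq]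
  simp

end Twist

/-! ### Equivariant maps on cosets -/

section Cosets

variable {k L : Type*} [Field k] [Field L] [Algebra k L] (F : IntermediateField k L)

@[simp]
theorem cosetApply_mk (g : L ≃ₐ[k] L) (x : F) : cosetApply F (g : Cosets F) x = g x := rfl

theorem cosetApply_smul (g : L ≃ₐ[k] L) (q : Cosets F) (x : F) :
    cosetApply F (g • q) x = g (cosetApply F q x) := by
  induction q using QuotientGroup.induction_on
  rfl

/-- The embedding `F → L` attached to a coset. -/
def cosetHom (q : Cosets F) : F →ₐ[k] L where
  toFun := cosetApply F q
  map_one' := by induction q using QuotientGroup.induction_on; simp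
  map_mul' x y := by induction q using QuotientGroup.induction_on; simp
  map_zero' := by induction q using QuotientGroup.induction_on; simp
  map_add' x y := by induction q using QuotientGroup.induction_on; simp
  commutes' r := by
    induction q using QuotientGroup.induction_on
    rw [cosetApply_mk]
    exact AlgEquiv.commutes _ r

@[simp]
theorem cosetHom_apply (q : Cosets F) (x : F) : cosetHom F q x = cosetApply F q x := rfl

theorem cosetHom_injective : Function.Injective (cosetHom F) := by
  intro q r h
  induction q using QuotientGroup.induction_on with | _ a
  induction r using QuotientGroup.induction_on with | _ b
  refine QuotientGroup.eq.2 ((IntermediateField.mem_fixingSubgroup_iff F _).2 fun x hx => ?_)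
  have : a x = b x := DFunLike.congr_fun h (⟨x, hx⟩ : F)
  rw [AlgEquiv.mul_apply, ← this]
  exact a.symm_apply_apply x

/-- The embedding of `F` in `Map(G / G', L)`. -/
def cosetsHom : F →ₐ[k] (Cosets F → L) := AlgHom.pi (cosetHom F)

theorem cosetsHom_apply (x : F) (q : Cosets F) : cosetsHom F x q = cosetApply F q x := rfl

theorem cosetsHom_injective : Function.Injective (cosetsHom F) := by
  intro x y h
  exact Subtype.ext (congrFun h ((1 : L ≃ₐ[k] L) : Cosets F))

/-- `F` consists of the equivariant maps `G / G' → L`: such a map is determined by its value at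
the trivial coset, which is fixed by `G'`. -/
theorem exists_cosetsHom_eq [FiniteDimensional k L] [IsGalois k L] (f : Cosets F → L)
    (hf : ∀ (g : L ≃ₐ[k] L) q, f (g • q) = g (f q)) : ∃ x, cosetsHom F x = f := by
  have hmem : f ((1 : L ≃ₐ[k] L) : Cosets F) ∈ F := by
    refine (IsGalois.fixedField_fixingSubgroup F).le
      ((IntermediateField.mem_fixedField_iff _ _).2 fun g hg => ?_)
    rw [← hf]
    congr 1
    exact QuotientGroup.eq.2 (by simpa using hg)
  refine ⟨⟨_, hmem⟩, funext fun q => ?_⟩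
  induction q using QuotientGroup.induction_on with | _ a
  rw [cosetsHom_apply, cosetApply_mk, ← hf]
  exact congrArg (fun b : L ≃ₐ[k] L => f (b : Cosets F)) (mul_one a)

end Cosets

/-! ### The permutation action of a group algebra -/

section Perm

variable {L X : Type*} [Field L] (N : Subgroup (Equiv.Perm X))

/-- The permutation action of `L[N]` on `Map(X, L)`, `(n f)(q) = f (n⁻¹ q)`. -/
noncomputable def permAction : MonoidAlgebra L N →ₐ[L] Module.End L (X → L) :=
  MonoidAlgebra.lift L (Module.End L (X → L)) N
    { toFun := fun n => LinearMap.funLeft L L ((n⁻¹ : N) : Equiv.Perm X)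
      map_one' := by ext; simp
      map_mul' := fun m n => by
        refine LinearMap.ext fun f => funext fun q => ?_
        simp [LinearMap.funLeft_apply] }

theorem permAction_apply (x : MonoidAlgebra L N) (f : X → L) (q : X) :
    permAction N x f q = x.coeff.sum fun n c => c * f ((n⁻¹ : N).1 q) := by
  rw [permAction, MonoidAlgebra.lift_apply, Finsupp.sum, LinearMap.sum_apply, Finset.sum_apply]
  rfl

theorem permAction_apply_fintype [Fintype N] (x : MonoidAlgebra L N) (f : X → L) (q : X) :
    permAction N x f q = ∑ n, x.coeff n * f ((n⁻¹ : N).1 q) := by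
  rw [permAction_apply, Finsupp.sum_fintype _ _ (by simp)]

/-- On constant functions `L[N]` acts through its counit. -/
theorem permAction_one_apply [Fintype N] (x : MonoidAlgebra L N) (q : X) :
    permAction N x 1 q = Coalgebra.counit (R := L) x := by
  induction x using MonoidAlgebra.induction_linear with
  | zero => simp
  | add x y hx hy => rw [map_add, map_add, ← hx, ← hy]; rfl
  | single n a => simp [permAction_apply]

/-- On products of functions `L[N]` acts through its comultiplication, because the elements of `N`
are group-like and act by algebra automorphisms. -/
theorem permAction_mul_apply (x : MonoidAlgebra L N) (f f' : X → L) (q : X) :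
    permAction N x (f * f') q = LinearMap.mul' L L
      (TensorProduct.map ((LinearMap.proj q).comp ((permAction N).toLinearMap.flip f))
        ((LinearMap.proj q).comp ((permAction N).toLinearMap.flip f'))
        (Coalgebra.comul (R := L) x)) := by
  induction x using MonoidAlgebra.induction_linear with
  | zero => simp
  | add x y hx hy => simp only [map_add, ← hx, ← hy]; rfl
  | single n a => simp [permAction_apply, mul_left_comm]

end Perm

/-! ### The Hopf Galois structure of a regular group -/

section Action

universe u' v'

variable {k : Type u'} {L : Type v'} [Field k] [Field L] [Algebra k L] {F : IntermediateField k L}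
  {N : Subgroup (Equiv.Perm (Cosets F))}

/-- The action of `Gal(L/k)` by conjugation on a group of permutations of `G / G'` normalized by
the left translations. -/
noncomputable def conjAction (hN : translations F ≤ Subgroup.normalizer N) :
    (L ≃ₐ[k] L) →* MulAut N :=
  N.normalizerMonoidHom.comp ((Subgroup.inclusion hN).comp
    (MulAction.toPermHom (L ≃ₐ[k] L) (Cosets F)).rangeRestrict)

theorem conjAction_apply (hN : translations F ≤ Subgroup.normalizer N) (g : L ≃ₐ[k] L) (n : N)
    (q : Cosets F) : (conjAction hN g n).1 (g • q) = g • n.1 q := by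
  change g • n.1 (g⁻¹ • g • q) = g • n.1 q
  rw [inv_smul_smul]

/-- The fixed algebra preserves the space of equivariant maps. -/
theorem permAction_smul [Finite N] (hN : translations F ≤ Subgroup.normalizer N)
    {x : MonoidAlgebra L N} (hx : x ∈ fixedAlgebra (conjAction hN)) (f : Cosets F → L)
    (hf : ∀ (g : L ≃ₐ[k] L) q, f (g • q) = g (f q)) (g : L ≃ₐ[k] L) (q : Cosets F) :
    permAction N x f (g • q) = g (permAction N x f q) := by
  have := Fintype.ofFinite N
  rw [permAction_apply_fintype, permAction_apply_fintype, map_sum]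
  refine (Fintype.sum_equiv (conjAction hN g).toEquiv _ _ fun n => ?_).symm
  change _ = x.coeff (conjAction hN g n) * f (((conjAction hN g n)⁻¹ : N).1 (g • q))
  rw [coeff_of_mem_fixedAlgebra hx, ← map_inv, conjAction_apply, hf, map_mul]

variable [FiniteDimensional k L] [IsGalois k L]

/-- The action of the fixed algebra of `L[N]` on the equivariant maps `G / G' → L`, seen on `F`. -/
theorem exists_action [Finite N] (hN : translations F ≤ Subgroup.normalizer N) :
    ∃ μ : fixedAlgebra (conjAction hN) →ₐ[k] Module.End k F, ∀ h x,
      cosetsHom F (μ h x) = permAction N h.1 (cosetsHom F x) := by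
  have key : ∀ h : fixedAlgebra (conjAction hN), ∃ M : Module.End k F, ∀ x,
      cosetsHom F (M x) = permAction N h.1 (cosetsHom F x) := fun h =>
    exists_linearMap_comp_eq (cosetsHom F).toLinearMap (cosetsHom_injective F)
      (((permAction N h.1).restrictScalars k) ∘ₗ (cosetsHom F).toLinearMap) fun x =>
      exists_cosetsHom_eq F _ (permAction_smul hN h.2 _ fun g q => cosetApply_smul F g q x)
  choose M hM using key
  have hext : ∀ A B : Module.End k F, (∀ x, cosetsHom F (A x) = cosetsHom F (B x)) → A = B :=
    fun A B h => LinearMap.ext fun x => cosetsHom_injective F (h x)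
  refine ⟨AlgHom.ofLinearMap ⟨⟨M, fun a b => hext _ _ fun x => ?_⟩, fun r a => hext _ _ fun x => ?_⟩
    (hext _ _ fun x => ?_) fun a b => hext _ _ fun x => ?_, hM⟩
  · simp [hM]
  · simp only [RingHom.id_apply, LinearMap.smul_apply, map_smul, hM]
    rw [Subalgebra.coe_smul, ← algebraMap_smul L r a.1, map_smul, LinearMap.smul_apply,
      algebraMap_smul]
  · simp [hM]
  · simp [hM]

omit [FiniteDimensional k L] in
theorem card_eq_finrank (hreg : IsRegular N) : Nat.card N = Module.finrank k F := by
  rw [IntermediateField.finrank_eq_fixingSubgroup_index, Subgroup.index]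
  refine Nat.card_eq_of_bijective (fun n : N => n.1 ((1 : L ≃ₐ[k] L) : Cosets F)) ⟨?_, ?_⟩
  · intro m n h
    exact Subtype.ext ((hreg _ _).unique ⟨m.2, h⟩ ⟨n.2, rfl⟩)
  · intro q
    obtain ⟨n, ⟨hn, hq⟩, -⟩ := hreg ((1 : L ≃ₐ[k] L) : Cosets F) q
    exact ⟨⟨n, hn⟩, hq⟩

/-- The map `j` is injective, because the embeddings of `F` in `L` are linearly independent. -/
theorem galoisMap_injective [Finite N] (hreg : IsRegular N)
    (hN : translations F ≤ Subgroup.normalizer N)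
    (D : HopfForm L (fixedAlgebra (conjAction hN)).val)
    (μ : fixedAlgebra (conjAction hN) →ₐ[k] Module.End k F)
    (hμ : ∀ h x, cosetsHom F (μ h x) = permAction N h.1 (cosetsHom F x)) :
    letI := D.hopfAlgebra
    Function.Injective (galoisMap μ) := by
  classical
  let := D.hopfAlgebra
  have := Fintype.ofFinite N
  let b := Module.Basis.ofVectorSpace k (fixedAlgebra (conjAction hN))
  let b' := (isBaseChange_fixedAlgebra (conjAction hN)).basis b
  have hb : ∀ i, b' i = b i := fun i => (isBaseChange_fixedAlgebra _).basis_apply b i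
  rw [injective_iff_map_eq_zero]
  intro z hz
  obtain ⟨s, rfl⟩ := (TensorProduct.equivFinsuppOfBasisRight b).symm.surjective z
  suffices hs : s = 0 by rw [hs, map_zero]
  rw [TensorProduct.equivFinsuppOfBasisRight_symm_apply, Finsupp.sum, map_sum] at hz
  -- The values of `s` at a coset `q` are the coefficients of an `L`-linear relation in `b'`.
  have hrel : ∀ q : Cosets F, ∑ i ∈ s.support, cosetApply F q (s i) • b' i = 0 := by
    intro q
    have hind := (linearIndependent_toLinearMap k F L).comp
      (fun n : N => cosetHom F ((n⁻¹ : N).1 q)) fun m n h => by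
        have h' := cosetHom_injective F h
        exact inv_injective (Subtype.ext ((hreg _ _).unique ⟨(m⁻¹).2, rfl⟩ ⟨(n⁻¹).2, h'.symm⟩))
    have hzero := Fintype.linearIndependent_iff.1 hind
      (fun n => ∑ i ∈ s.support, cosetApply F q (s i) * (b i).1.coeff n) <| by
        refine LinearMap.ext fun t => ?_
        have ht : cosetsHom F ((∑ i ∈ s.support, galoisMap μ (s i ⊗ₜ b i)) t) q = 0 := by
          rw [hz, LinearMap.zero_apply, map_zero, Pi.zero_apply]
        rw [LinearMap.sum_apply, map_sum, Finset.sum_apply] at ht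
        rw [LinearMap.sum_apply]
        simp only [galoisMap_tmul, map_mul, Pi.mul_apply, hμ, permAction_apply_fintype,
          Finset.mul_sum] at ht
        rw [Finset.sum_comm] at ht
        rw [LinearMap.zero_apply, ← ht]
        refine Finset.sum_congr rfl fun n _ => ?_
        simp [Finset.sum_mul, mul_assoc, cosetsHom_apply]
    refine MonoidAlgebra.ext (Finsupp.ext fun n => ?_)
    rw [MonoidAlgebra.coeff_sum, Finsupp.finsetSum_apply]
    simpa [hb] using hzero n
  ext i
  by_cases hi : i ∈ s.support
  · have := linearIndependent_iff'.1 b'.linearIndependent s.support _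
      (hrel ((1 : L ≃ₐ[k] L) : Cosets F)) i hi
    simpa using this
  · simpa using hi

/-- A regular group `N` of permutations of `G / G'` normalized by the left translations gives a
Hopf Galois structure: the Hopf algebra is the fixed algebra of `L[N]`. -/
theorem exists_isHopfGaloisAction [IsNormalClosure k F L] (hreg : IsRegular N)
    (hN : translations F ≤ Subgroup.normalizer N) :
    ∃ (H : Type v') (_ : Ring H) (_ : HopfAlgebra k H) (μ : H →ₐ[k] Module.End k F),
      IsHopfGaloisAction μ ∧ ComesFrom F N μ := by
  have : Finite N := Nat.finite_of_card_ne_zero <| by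
    rw [card_eq_finrank hreg]; exact Module.finrank_pos.ne'
  have := Fintype.ofFinite N
  obtain ⟨D⟩ := exists_hopfForm_fixedAlgebra (conjAction hN)
  obtain ⟨μ, hμ⟩ := exists_action hN
  have hrank := finrank_fixedAlgebra (conjAction hN)
  rw [card_eq_finrank hreg] at hrank
  have hfin : Module.Finite k (fixedAlgebra (conjAction hN)) :=
    Module.finite_of_finrank_pos (hrank ▸ Module.finrank_pos)
  have hinj := galoisMap_injective hreg hN D μ hμ
  let := D.hopfAlgebra
  refine ⟨fixedAlgebra (conjAction hN), inferInstance, D.hopfAlgebra, μ,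
    ⟨hfin, D.isCocomm, ⟨fun h => ?_, fun h s t => ?_⟩, hinj, ?_⟩, D.bialgEquiv, fun h x q => ?_⟩
  · refine cosetsHom_injective F (funext fun q => ?_)
    rw [hμ, map_one, permAction_one_apply, AlgHom.commutes, Pi.algebraMap_apply]
    exact (D.map_counit h).symm
  · refine cosetsHom_injective F (funext fun q => ?_)
    rw [hμ, map_mul, permAction_mul_apply]
    have hc := D.map_comul h
    change _ = cosetsHom F (LinearMap.mul' k F
      (TensorProduct.map (μ.toLinearMap.flip s) (μ.toLinearMap.flip t) (D.comul h))) q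
    change LinearMap.mul' L L (TensorProduct.map _ _
      (Coalgebra.comul (R := L) ((fixedAlgebra (conjAction hN)).val h))) = _
    rw [← hc]
    induction D.comul h with
    | zero => simp only [map_zero, Pi.zero_apply]
    | add x y hx hy => simp only [map_add, hx, hy, Pi.add_apply]
    | tmul a b => simp [hμ]
  · exact (LinearMap.injective_iff_surjective_of_finrank_eq_finrank
      (by rw [Module.finrank_tensorProduct, hrank, Module.finrank_linearMap])).1 hinj
  · rw [← cosetsHom_apply, hμ, permAction_apply, D.bialgEquiv_tmul, one_smul]
    rfl

end Action

/-! ### Regular groups from normal complements -/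

section BiTranslations

variable {G : Type*} [Group G] {B : Subgroup G}

/-- The permutation `a B ↦ m a c B` of `G / B`, for `c` in the normalizer of `B`. -/
def biTranslate (m : G) {c : G} (hc : c ∈ Subgroup.normalizer (B : Set G)) :
    Equiv.Perm (G ⧸ B) where
  toFun := Quotient.map' (fun a => m * a * c) fun a b hab => by
    rw [QuotientGroup.leftRel_apply] at hab ⊢
    rw [Subgroup.mem_normalizer_iff''] at hc
    convert (hc _).1 hab using 1
    group
  invFun := Quotient.map' (fun a => m⁻¹ * a * c⁻¹) fun a b hab => by
    rw [QuotientGroup.leftRel_apply] at hab ⊢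
    rw [Subgroup.mem_normalizer_iff] at hc
    convert (hc _).1 hab using 1
    group
  left_inv q := by
    induction q using QuotientGroup.induction_on with | _ a
    exact congrArg (QuotientGroup.mk (s := B)) (by group)
  right_inv q := by
    induction q using QuotientGroup.induction_on with | _ a
    exact congrArg (QuotientGroup.mk (s := B)) (by group)

theorem biTranslate_mk (m : G) {c : G} (hc : c ∈ Subgroup.normalizer (B : Set G)) (a : G) :
    biTranslate m hc (a : G ⧸ B) = ((m * a * c : G) : G ⧸ B) := rfl

variable (B) in
/-- The group of the permutations `a B ↦ m a c B` of `G / B` with `m ∈ M` and `c ∈ C`, where only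
those `c` count for which the permutation is well defined. -/
def biTranslations (M C : Subgroup G) : Subgroup (Equiv.Perm (G ⧸ B)) where
  carrier := {n | ∃ m ∈ M, ∃ c ∈ C, ∀ a : G, n (a : G ⧸ B) = ((m * a * c : G) : G ⧸ B)}
  one_mem' := ⟨1, M.one_mem, 1, C.one_mem, fun a => by simp⟩
  mul_mem' := by
    rintro n n' ⟨m, hm, c, hc, h⟩ ⟨m', hm', c', hc', h'⟩
    refine ⟨m * m', M.mul_mem hm hm', c' * c, C.mul_mem hc' hc, fun a => ?_⟩
    rw [Equiv.Perm.mul_apply, h', h]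
    exact congrArg _ (by group)
  inv_mem' := by
    rintro n ⟨m, hm, c, hc, h⟩
    refine ⟨m⁻¹, M.inv_mem hm, c⁻¹, C.inv_mem hc, fun a => ?_⟩
    rw [Equiv.Perm.inv_eq_iff_eq, h]
    exact congrArg _ (by group)

variable {M C : Subgroup G}

/-- If `M` is a normal complement of `C` and `B` is a normal subgroup of `C`, then the
permutations `a B ↦ m a c B` form a regular group, isomorphic to `M × C / B`. -/
theorem isRegular_biTranslations [M.Normal] (hMC : Subgroup.IsComplement' M C) (hBC : B ≤ C)
    (hB : C ≤ Subgroup.normalizer (B : Set G)) : IsRegular (biTranslations B M C) := by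
  intro x y
  induction x using QuotientGroup.induction_on with | _ a
  induction y using QuotientGroup.induction_on with | _ b
  obtain ⟨⟨⟨m, hm⟩, ⟨c, hc⟩⟩, hab⟩ := hMC.2 (a⁻¹ * b)
  dsimp only at hab
  have hb : b = a * m * a⁻¹ * a * c := by
    rw [← mul_inv_cancel_left a b, ← hab]; group
  refine ⟨biTranslate (a * m * a⁻¹) (hB hc), ⟨⟨_, Subgroup.Normal.conj_mem ‹_› m hm a, c, hc,
    biTranslate_mk _ _⟩, by rw [biTranslate_mk, hb]⟩, ?_⟩
  rintro n ⟨⟨m', hm', c', hc', hn⟩, hna⟩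
  rw [hn, hb, QuotientGroup.eq] at hna
  have hmem : a⁻¹ * m'⁻¹ * a * m ∈ C := by
    have := C.mul_mem (C.mul_mem hc' (hBC hna)) (C.inv_mem hc)
    rwa [show c' * ((m' * a * c')⁻¹ * (a * m * a⁻¹ * a * c)) * c⁻¹ = a⁻¹ * m'⁻¹ * a * m by
      group] at this
  have hmem' : a⁻¹ * m'⁻¹ * a * m ∈ M := by
    have := M.mul_mem (Subgroup.Normal.conj_mem ‹M.Normal› m'⁻¹ (M.inv_mem hm') a⁻¹) hm
    rwa [inv_inv] at this
  have h1 := Subgroup.disjoint_def.1 hMC.disjoint hmem' hmem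
  have h2 : m' = a * m * a⁻¹ := by
    have : m' = a * m * (a⁻¹ * m'⁻¹ * a * m)⁻¹ * a⁻¹ := by group
    rw [this, h1]; group
  ext q
  induction q using QuotientGroup.induction_on with | _ b'
  rw [hn, biTranslate_mk, h2, QuotientGroup.eq]
  rw [h2] at hna
  convert hna using 1
  group

/-- Conjugation by the left translation by `g` replaces `m` by `g m g⁻¹` and leaves `c` as it is. -/
theorem range_toPermHom_le_normalizer [M.Normal] :
    (MulAction.toPermHom G (G ⧸ B)).range ≤
      Subgroup.normalizer (biTranslations B M C : Set (Equiv.Perm (G ⧸ B))) := by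
  have key : ∀ g : G, ∀ n ∈ biTranslations B M C, MulAction.toPermHom G (G ⧸ B) g * n *
      (MulAction.toPermHom G (G ⧸ B) g)⁻¹ ∈ biTranslations B M C := by
    rintro g n ⟨m, hm, c, hc, h⟩
    refine ⟨g * m * g⁻¹, Subgroup.Normal.conj_mem ‹_› m hm g, c, hc, fun a => ?_⟩
    rw [← map_inv]
    change g • n ((g⁻¹ * a : G) : G ⧸ B) = _
    rw [h]
    exact congrArg (QuotientGroup.mk (s := B)) (by change g * _ = _; group)
  rintro _ ⟨g, rfl⟩
  rw [Subgroup.mem_normalizer_iff]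
  refine fun n => ⟨key g n, fun hn => ?_⟩
  have := key g⁻¹ _ hn
  rwa [map_inv, show ∀ x y : Equiv.Perm (G ⧸ B), x⁻¹ * (x * y * x⁻¹) * x⁻¹⁻¹ = y by
    intro x y; group] at this

end BiTranslations

/-! ### Elementary abelian groups of order eight -/

/-- A group of order `8` and exponent `2` is a vector space of dimension `3` over `𝔽₂`. -/
theorem nonempty_mulEquiv_of_sq_eq_one {A : Type*} [Group A] (hA : ∀ a : A, a * a = 1)
    (hcard : Nat.card A = 8) : Nonempty (A ≃* (Fin 3 → Multiplicative (ZMod 2))) := by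
  let : CommGroup A := { ‹Group A› with
    mul_comm := fun a b => by
      have h1 : ∀ a : A, a⁻¹ = a := fun a => inv_eq_of_mul_eq_one_left (hA a)
      calc a * b = (a * b)⁻¹ := (h1 _).symm
        _ = b * a := by rw [mul_inv_rev, h1, h1] }
  let : Module (ZMod 2) (Additive A) := AddCommGroup.zmodModule (n := 2) fun a => by
    rw [two_nsmul]; exact hA a.toMul
  have : Finite A := Nat.finite_of_card_ne_zero (by omega)
  have : Finite (Additive A) := this
  have : Module.Finite (ZMod 2) (Additive A) := Module.Finite.of_finite
  have hrank : Module.finrank (ZMod 2) (Additive A) = 3 := by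
    have h := Module.natCard_eq_pow_finrank (K := ZMod 2) (V := Additive A)
    rw [show Nat.card (Additive A) = 8 from hcard, Nat.card_zmod] at h
    exact (Nat.pow_right_injective (le_refl 2) (h.symm.trans (by norm_num : 8 = 2 ^ 3)))
  let e : Additive A ≃ₗ[ZMod 2] (Fin 3 → ZMod 2) := LinearEquiv.ofFinrankEq _ _ (by simp [hrank])
  exact ⟨{ toFun := fun a i => Multiplicative.ofAdd (e (Additive.ofMul a) i)
           invFun := fun f => (e.symm fun i => (f i).toAdd).toMul
           left_inv := fun a => by simp
           right_inv := fun f => by simp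
           map_mul' := fun a b => by ext i; simp }⟩

/-! ### Normal closures -/

section NormalClosure

variable {k L : Type*} [Field k] [Field L] [Algebra k L]

theorem isSeparable_of_isNormalClosure (K : IntermediateField k L) [FiniteDimensional k K]
    [Algebra.IsSeparable k K] [IsNormalClosure k K L] : Algebra.IsSeparable k L := by
  have htop := (Algebra.IsAlgebraic.isNormalClosure_iff.1 ‹IsNormalClosure k K L›).2
  rw [normalClosure_def] at htop
  have : ∀ f : K →ₐ[k] L, Algebra.IsSeparable k f.fieldRange := fun f =>
    AlgEquiv.Algebra.isSeparable (AlgEquiv.ofInjectiveField f)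
  have : Algebra.IsSeparable k (⊤ : IntermediateField k L) := htop ▸ inferInstance
  exact AlgEquiv.Algebra.isSeparable IntermediateField.topEquiv

theorem finiteDimensional_of_isNormalClosure (K : IntermediateField k L) [FiniteDimensional k K]
    [IsNormalClosure k K L] : FiniteDimensional k L := by
  have htop := (Algebra.IsAlgebraic.isNormalClosure_iff.1 ‹IsNormalClosure k K L›).2
  have : FiniteDimensional k (⊤ : IntermediateField k L) := htop ▸ inferInstance
  exact IntermediateField.topEquiv.toLinearEquiv.finiteDimensional

theorem isNormalClosure_of_le [FiniteDimensional k L] {K F : IntermediateField k L}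
    [IsNormalClosure k K L] (h : K ≤ F) : IsNormalClosure k F L := by
  have : Normal k L := IsNormalClosure.normal (K := K)
  have htop := (Algebra.IsAlgebraic.isNormalClosure_iff.1 ‹IsNormalClosure k K L›).2
  refine Algebra.IsAlgebraic.isNormalClosure_iff.2 ⟨fun x => ?_, ?_⟩
  · rw [← minpoly.algHom_eq F.val F.val.injective]
    exact Normal.splits ‹_› _
  · exact top_le_iff.1 (htop ▸ IntermediateField.normalClosure_mono K F h)

/-- The action on the cosets of `Gal(L/F)` is faithful, since `L` is generated by the conjugates of
`F`. -/
theorem toPermHom_injective [FiniteDimensional k L] (F : IntermediateField k L)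
    [IsNormalClosure k F L] :
    Function.Injective (MulAction.toPermHom (L ≃ₐ[k] L) (Cosets F)) := by
  have : Normal k L := IsNormalClosure.normal (K := F)
  have htop := (Algebra.IsAlgebraic.isNormalClosure_iff.1 ‹IsNormalClosure k F L›).2
  rw [injective_iff_map_eq_one]
  intro g hg
  have hle : (⊤ : IntermediateField k L) ≤ IntermediateField.fixedField (Subgroup.zpowers g) := by
    rw [← htop, IntermediateField.normalClosure_def'']
    refine iSup_le fun f => ?_
    rintro _ ⟨x, hx, rfl⟩
    refine (IntermediateField.mem_fixedField_iff _ _).2 fun σ hσ => ?_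
    have hσ' : MulAction.toPermHom (L ≃ₐ[k] L) (Cosets F) σ = 1 :=
      (Subgroup.zpowers_le (H := (MulAction.toPermHom (L ≃ₐ[k] L) (Cosets F)).ker)).2 hg hσ
    have := cosetApply_smul F σ (f : Cosets F) ⟨x, hx⟩
    have hfix : σ • (f : Cosets F) = f := by
      change MulAction.toPermHom (L ≃ₐ[k] L) (Cosets F) σ (f : Cosets F) = f
      rw [hσ', Equiv.Perm.one_apply]
    rw [hfix] at this
    exact this.symm
  ext x
  exact (IntermediateField.mem_fixedField_iff _ _).1 (hle (IntermediateField.mem_top (x := x))) g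
    (Subgroup.mem_zpowers g)

end NormalClosure

/-! ### Permutations of four letters -/

section PermFour

open Equiv

/-- The even permutations of four letters of order at most `2`, which form the normal Klein
four-group. -/
def kleinFour : Subgroup (Perm (Fin 4)) where
  carrier := {σ | σ * σ = 1 ∧ Perm.sign σ = 1}
  one_mem' := by simp
  mul_mem' {σ τ} hσ hτ := by
    revert σ τ
    decide +kernel
  inv_mem' {σ} hσ := ⟨by rw [← mul_inv_rev, hσ.1, inv_one], by rw [Perm.sign_inv, hσ.2]⟩

instance : kleinFour.Normal where
  conj_mem σ hσ τ := by
    refine ⟨?_, by simp [hσ.2]⟩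
    rw [show τ * σ * τ⁻¹ * (τ * σ * τ⁻¹) = τ * (σ * σ) * τ⁻¹ by group, hσ.1]
    group

theorem eq_one_of_even_of_fix :
    ∀ σ : Perm (Fin 4), σ * σ = 1 → Perm.sign σ = 1 → σ 0 = 0 → σ = 1 := by decide +kernel

theorem exists_kleinFour_apply_zero :
    ∀ i : Fin 4, ∃ σ : Perm (Fin 4), (σ * σ = 1 ∧ Perm.sign σ = 1) ∧ σ 0 = i := by decide +kernel

theorem eq_or_eq_of_cube_eq_one : ∀ σ : Perm (Fin 4), σ 0 = 0 → σ ^ 3 = 1 → σ ≠ 1 →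
    ∀ τ : Perm (Fin 4), τ 0 = 0 → τ ^ 3 = 1 → τ = 1 ∨ τ = σ ∨ τ = σ * σ := by decide +kernel

theorem cube_sq_eq_one : ∀ σ : Perm (Fin 4), σ 0 = 0 → (σ * σ) ^ 3 = 1 := by decide +kernel

/-- The index of a subgroup of order `8` is `3`, so a normal one contains all cubes, in particular
all transpositions, and these generate the symmetric group. -/
theorem card_ne_eight_of_normal (M : Subgroup (Perm (Fin 4))) [M.Normal] : Nat.card M ≠ 8 := by
  intro h
  have hcard : Nat.card (Perm (Fin 4)) = 24 := by
    rw [Nat.card_eq_fintype_card, Fintype.card_perm]; rfl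
  have hindex : M.index = 3 := by
    have := M.card_mul_index
    rw [h, hcard] at this
    omega
  have htop : M = ⊤ := by
    rw [← top_le_iff, ← Perm.closure_isSwap, Subgroup.closure_le]
    rintro σ hσ
    have := M.pow_index_mem σ
    rw [hindex] at this
    have h2 : σ * σ = 1 := by
      obtain ⟨x, y, -, rfl⟩ := hσ
      exact swap_mul_self x y
    rwa [pow_three, h2, mul_one] at this
  rw [htop, Subgroup.card_top] at h
  omega

end PermFour

/-! ### Subgroups of a point stabilizer in the symmetric group -/

section SymmetricGroup

open Equiv

variable {G : Type*} [Group G] (e : G ≃* Perm (Fin 4))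

/-- The subgroup of `G ≃ S₄` fixing the letter `0`. -/
def pointStabilizer : Subgroup G := (MulAction.stabilizer (Perm (Fin 4)) (0 : Fin 4)).comap e

theorem mem_pointStabilizer {g : G} : g ∈ pointStabilizer e ↔ e g 0 = 0 := Iff.rfl

/-- The Klein four-group acts regularly on the letters, so it is a complement of a stabilizer. -/
theorem isComplement_kleinFour :
    Subgroup.IsComplement' (kleinFour.comap (e : G →* Perm (Fin 4))) (pointStabilizer e) := by
  refine Subgroup.isComplement'_of_disjoint_and_mul_eq_univ ?_ ?_
  · refine Subgroup.disjoint_def.2 fun {g} hg hg0 => ?_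
    have h : e g * e g = 1 ∧ Perm.sign (e g) = 1 := hg
    exact e.map_eq_one_iff.1 (eq_one_of_even_of_fix _ h.1 h.2 hg0)
  · refine Set.eq_univ_of_forall fun g => ?_
    obtain ⟨σ, hσ, h0⟩ := exists_kleinFour_apply_zero (e g 0)
    refine ⟨e.symm σ, ?_, (e.symm σ)⁻¹ * g, ?_, mul_inv_cancel_left _ _⟩
    · change e (e.symm σ) ∈ kleinFour
      rwa [e.apply_symm_apply]
    · change e ((e.symm σ)⁻¹ * g) 0 = 0
      rw [map_mul, map_inv, e.apply_symm_apply, Perm.mul_apply]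
      exact Perm.inv_eq_iff_eq.2 h0.symm

variable {e}

/-- A subgroup of order `3` of the stabilizer of a letter consists of all elements of order `1` or
`3` of that stabilizer. -/
theorem mem_of_cube_eq_one {B : Subgroup G} (hB : B ≤ pointStabilizer e) (hcard : Nat.card B = 3)
    {g : G} (hg : g ∈ pointStabilizer e) (hg3 : g ^ 3 = 1) : g ∈ B := by
  have hne : B ≠ ⊥ := by rintro rfl; simp at hcard
  obtain ⟨b, hb, hb1⟩ := B.ne_bot_iff_exists_ne_one.1 hne |>.elim fun b hb =>
    (⟨b.1, b.2, fun h => hb (Subtype.ext h)⟩ : ∃ b ∈ B, b ≠ 1)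
  have hb3 : b ^ 3 = 1 := by
    have := pow_card_eq_one' (x := (⟨b, hb⟩ : B))
    rw [hcard] at this
    exact congrArg Subtype.val this
  rcases eq_or_eq_of_cube_eq_one (e b) (hB hb) (by rw [← map_pow, hb3, map_one])
    (fun h => hb1 (e.map_eq_one_iff.1 h)) (e g) hg (by rw [← map_pow, hg3, map_one]) with h | h | h
  · rw [e.map_eq_one_iff.1 h]; exact B.one_mem
  · rwa [e.injective h]
  · rw [← map_mul] at h
    rw [e.injective h]; exact B.mul_mem hb hb

theorem mul_self_mem {B : Subgroup G} (hB : B ≤ pointStabilizer e) (hcard : Nat.card B = 3)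
    {g : G} (hg : g ∈ pointStabilizer e) : g * g ∈ B :=
  mem_of_cube_eq_one hB hcard (mul_mem hg hg) <| e.injective <| by
    rw [map_pow, map_mul, map_one]
    exact cube_sq_eq_one (e g) hg

theorem card_pointStabilizer : Nat.card (pointStabilizer e) = 6 := by
  have h : Nat.card (pointStabilizer e) = Nat.card {σ : Perm (Fin 4) // σ 0 = 0} :=
    Nat.card_congr (e.toEquiv.subtypeEquiv fun g => Iff.rfl)
  rw [h, Nat.card_eq_fintype_card]
  decide +kernel

/-- The stabilizer of a letter is a symmetric group on three letters, whose only subgroups that are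
not normal are those of order `2`. -/
theorem pointStabilizer_le_normalizer {B : Subgroup G} (hB : B ≤ pointStabilizer e)
    (hcard : Nat.card B ≠ 2) : pointStabilizer e ≤ Subgroup.normalizer (B : Set G) := by
  have hG : Finite (pointStabilizer e) :=
    Nat.finite_of_card_ne_zero (by rw [card_pointStabilizer]; norm_num)
  have hdvd : Nat.card B ∣ 6 := card_pointStabilizer (e := e) ▸ Subgroup.card_dvd_of_le hB
  have hle : Nat.card B ≤ 6 := Nat.le_of_dvd (by norm_num) hdvd
  have hconj : ∀ c ∈ pointStabilizer e, ∀ b ∈ B, c * b * c⁻¹ ∈ B := by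
    intro c hc b hb
    have hmem : c * b * c⁻¹ ∈ pointStabilizer e := mul_mem (mul_mem hc (hB hb)) (inv_mem hc)
    interval_cases h : Nat.card B
    · simp at hdvd
    · rw [Subgroup.card_eq_one.1 h, Subgroup.mem_bot] at hb
      simp [hb, B.one_mem]
    · exact absurd rfl hcard
    · refine mem_of_cube_eq_one hB h hmem ?_
      have := pow_card_eq_one' (x := (⟨b, hb⟩ : B))
      rw [h] at this
      rw [conj_pow, show b ^ 3 = 1 from congrArg Subtype.val this, mul_one, mul_inv_cancel]
    · omega
    · omega
    · rwa [Subgroup.eq_of_le_of_card_ge hB (by rw [card_pointStabilizer, h])]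
  intro c hc
  rw [Subgroup.mem_normalizer_iff]
  refine fun b => ⟨hconj c hc b, fun hb => ?_⟩
  have := hconj c⁻¹ (inv_mem hc) _ hb
  rwa [show c⁻¹ * (c * b * c⁻¹) * c⁻¹⁻¹ = b by group] at this

/-- A subgroup of order `2` of the stabilizer of a letter is generated by a transposition, hence
is a complement of the alternating group. -/
theorem isComplement_alternatingGroup {B : Subgroup G} (hB : B ≤ pointStabilizer e)
    (hcard : Nat.card B = 2) :
    Subgroup.IsComplement' ((alternatingGroup (Fin 4)).comap (e : G →* Perm (Fin 4))) B := by
  have hsq : ∀ b ∈ B, e b * e b = 1 := fun b hb => by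
    have := pow_card_eq_one' (x := (⟨b, hb⟩ : B))
    rw [hcard] at this
    rw [← pow_two, ← map_pow, show b ^ 2 = 1 from congrArg Subtype.val this, map_one]
  have hdis : ∀ b ∈ B, Perm.sign (e b) = 1 → b = 1 := fun b hb hs =>
    e.map_eq_one_iff.1 (eq_one_of_even_of_fix _ (hsq b hb) hs (hB hb))
  have hne : B ≠ ⊥ := by rintro rfl; simp at hcard
  obtain ⟨b, hb, hb1⟩ := B.ne_bot_iff_exists_ne_one.1 hne |>.elim fun b hb =>
    (⟨b.1, b.2, fun h => hb (Subtype.ext h)⟩ : ∃ b ∈ B, b ≠ 1)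
  have hsign : Perm.sign (e b) = -1 :=
    (Int.units_eq_one_or _).resolve_left fun h => hb1 (hdis b hb h)
  refine Subgroup.isComplement'_of_disjoint_and_mul_eq_univ ?_ ?_
  · exact Subgroup.disjoint_def.2 fun {g} hg hgB => hdis g hgB hg
  · refine Set.eq_univ_of_forall fun g => ?_
    rcases Int.units_eq_one_or (Perm.sign (e g)) with h | h
    · exact ⟨g, h, 1, B.one_mem, mul_one g⟩
    · refine ⟨g * b⁻¹, ?_, b, hb, inv_mul_cancel_right g b⟩
      change Perm.sign (e (g * b⁻¹)) = 1
      rw [map_mul, map_inv, Perm.sign_mul, Perm.sign_inv, h, hsign]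
      rfl

end SymmetricGroup

/-! ### The Galois group of a quartic extension -/

section Quartic

variable {k L : Type*} [Field k] [Field L] [Algebra k L]

/-- The Galois group acts faithfully on the four cosets of `Gal(L/K)`, hence as `S₄`. -/
theorem exists_mulEquiv_fixingSubgroup_eq [FiniteDimensional k L] [IsGalois k L]
    (K : IntermediateField k L) [IsNormalClosure k K L] (hK : Module.finrank k K = 4)
    (hG : Nat.card (L ≃ₐ[k] L) = 24) :
    ∃ e : (L ≃ₐ[k] L) ≃* Equiv.Perm (Fin 4), K.fixingSubgroup = pointStabilizer e := by
  have hcard : Nat.card (Cosets K) = 4 := by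
    rw [← hK, IntermediateField.finrank_eq_fixingSubgroup_index]; rfl
  have : Finite (Cosets K) := Nat.finite_of_card_ne_zero (by omega)
  -- The trivial coset is labelled `0`, so that its stabilizer becomes the stabilizer of `0`.
  let φ₀ := Finite.equivFinOfCardEq hcard
  let q : Cosets K := ((1 : L ≃ₐ[k] L) : Cosets K)
  let φ : Cosets K ≃ Fin 4 := φ₀.trans (Equiv.swap (φ₀ q) 0)
  have hφ : φ q = 0 := by simp [φ]
  let f : (L ≃ₐ[k] L) →* Equiv.Perm (Fin 4) :=
    φ.permCongrHom.toMonoidHom.comp (MulAction.toPermHom (L ≃ₐ[k] L) (Cosets K))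
  have hf : Function.Injective f := φ.permCongrHom.injective.comp (toPermHom_injective K)
  have hbij : Function.Bijective f := by
    rw [Nat.bijective_iff_injective_and_card]
    refine ⟨hf, ?_⟩
    rw [hG, Nat.card_eq_fintype_card, Fintype.card_perm]; rfl
  refine ⟨MulEquiv.ofBijective f hbij, Subgroup.ext fun g => ?_⟩
  rw [mem_pointStabilizer, MulEquiv.ofBijective_apply, ← hφ]
  change _ ↔ φ (g • φ.symm (φ q)) = φ q
  rw [φ.symm_apply_apply, φ.apply_eq_iff_eq, eq_comm]
  change _ ↔ ((1 : L ≃ₐ[k] L) : Cosets K) = ((g * 1 : L ≃ₐ[k] L) : Cosets K)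
  rw [QuotientGroup.eq]
  simp

/-- A regular subgroup normalized by, and contained in, the left translations is the image of a
normal subgroup of the Galois group, of order `[F : k]`; but `S₄` has none of order `8`. -/
theorem not_isAlmostClassicallyGalois [FiniteDimensional k L] [IsGalois k L]
    (F : IntermediateField k L) [IsNormalClosure k F L] (hF : Module.finrank k F = 8)
    (e : (L ≃ₐ[k] L) ≃* Equiv.Perm (Fin 4)) : ¬ IsAlmostClassicallyGalois F := by
  rintro ⟨N, hreg, hnorm, hle⟩
  let f := MulAction.toPermHom (L ≃ₐ[k] L) (Cosets F)
  have hf : Function.Injective f := toPermHom_injective F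
  let M : Subgroup (Equiv.Perm (Fin 4)) := (N.comap f).map (e : (L ≃ₐ[k] L) →* Equiv.Perm (Fin 4))
  have hM : (N.comap f).Normal := ⟨fun n hn g => by
    have := (Subgroup.mem_normalizer_iff.1 (hnorm ⟨g, rfl⟩) _).1 hn
    rw [Subgroup.mem_comap, map_mul, map_mul, map_inv]
    exact this⟩
  have : M.Normal := hM.map _ e.surjective
  refine card_ne_eight_of_normal M ?_
  rw [Subgroup.card_map_of_injective e.injective, ← Subgroup.card_map_of_injective hf,
    Subgroup.map_comap_eq_self hle, card_eq_finrank hreg, hF]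

end Quartic

end HopfGalois

/-! ### Intermediate fields of the Galois closure of a quartic extension -/

theorem mainTheorem2 {k : Type u} [Field k] {L : Type v} [Field L] [Algebra k L]
    (K : IntermediateField k L) [Algebra.IsSeparable k K] (hK : Module.finrank k K = 4)
    [IsNormalClosure k K L] (hG : Nonempty ((L ≃ₐ[k] L) ≃* Equiv.Perm (Fin 4)))
    (F : IntermediateField k L) (hKF : K ≤ F) :
    HopfGalois.IsHopfGalois k F ∧
    ∃ _ : IsNormalClosure k F L,
      (Module.finrank k F = 12 → HopfGalois.IsAlmostClassicallyGalois F) ∧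
      (Module.finrank k F = 8 →
        ¬ HopfGalois.IsAlmostClassicallyGalois F ∧
        ∃ N : Subgroup (Equiv.Perm (HopfGalois.Cosets F)),
          HopfGalois.IsRegular N ∧
          HopfGalois.translations F ≤ Subgroup.normalizer N ∧
          Nonempty (N ≃* (Fin 3 → Multiplicative (ZMod 2))) ∧
          ∃ (H : Type v) (_ : Ring H) (_ : HopfAlgebra k H) (μ : H →ₐ[k] Module.End k F),
            HopfGalois.IsHopfGaloisAction μ ∧ HopfGalois.ComesFrom F N μ) := by
  open HopfGalois in
  have : FiniteDimensional k K := Module.finite_of_finrank_pos (by omega)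
  have : FiniteDimensional k L := finiteDimensional_of_isNormalClosure K
  have : Algebra.IsSeparable k L := isSeparable_of_isNormalClosure K
  have : Normal k L := IsNormalClosure.normal (K := K)
  have : IsGalois k L := ⟨⟩
  have : IsNormalClosure k F L := isNormalClosure_of_le hKF
  have hcard : Nat.card (L ≃ₐ[k] L) = 24 := by
    rw [Nat.card_congr hG.some.toEquiv, Nat.card_eq_fintype_card, Fintype.card_perm]; rfl
  obtain ⟨e, he⟩ := exists_mulEquiv_fixingSubgroup_eq K hK hcard
  have hB : F.fixingSubgroup ≤ pointStabilizer e := he ▸ IntermediateField.fixingSubgroup_le hKF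
  have hcardB : Nat.card F.fixingSubgroup * Module.finrank k F = 24 := by
    rw [IntermediateField.finrank_eq_fixingSubgroup_index, Subgroup.card_mul_index, hcard]
  -- If `Gal(L/F)` has order `2`, the alternating group acts regularly.
  have htwo : Nat.card F.fixingSubgroup = 2 → ∃ N : Subgroup (Equiv.Perm (Cosets F)),
      IsRegular N ∧ translations F ≤ Subgroup.normalizer N ∧ N ≤ translations F := fun h => by
    refine ⟨biTranslations F.fixingSubgroup
      ((alternatingGroup (Fin 4)).comap (e : (L ≃ₐ[k] L) →* Equiv.Perm (Fin 4))) F.fixingSubgroup,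
      isRegular_biTranslations (isComplement_alternatingGroup hB h) le_rfl Subgroup.le_normalizer,
      range_toPermHom_le_normalizer, ?_⟩
    rintro n ⟨m, -, c, hc, hn⟩
    refine ⟨m, Equiv.ext fun q => ?_⟩
    induction q using QuotientGroup.induction_on with | _ a
    rw [hn]
    exact QuotientGroup.eq.2 (by simpa [mul_assoc] using hc)
  -- Otherwise `Gal(L/F)` is normal in the point stabilizer, a complement of the Klein four-group.
  let N := biTranslations F.fixingSubgroup
    (kleinFour.comap (e : (L ≃ₐ[k] L) →* Equiv.Perm (Fin 4))) (pointStabilizer e)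
  have hN : Nat.card F.fixingSubgroup ≠ 2 → IsRegular N := fun h =>
    isRegular_biTranslations (isComplement_kleinFour e) hB (pointStabilizer_le_normalizer hB h)
  have hnorm : translations F ≤ Subgroup.normalizer N := range_toPermHom_le_normalizer
  refine ⟨?_, ‹_›, fun h => htwo (by rw [h] at hcardB; omega), fun h =>
    ⟨not_isAlmostClassicallyGalois F h e, N, ?_⟩⟩
  · by_cases h : Nat.card F.fixingSubgroup = 2
    · obtain ⟨N', hreg, hnorm', -⟩ := htwo h
      obtain ⟨H, i, i', μ, hμ, -⟩ := exists_isHopfGaloisAction hreg hnorm'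
      exact ⟨_, _, _, _, hμ⟩
    · obtain ⟨H, i, i', μ, hμ, -⟩ := exists_isHopfGaloisAction (hN h) hnorm
      exact ⟨_, _, _, _, hμ⟩
  · have h3 : Nat.card F.fixingSubgroup = 3 := by rw [h] at hcardB; omega
    have hreg : IsRegular N := hN (by omega)
    refine ⟨hreg, hnorm, nonempty_mulEquiv_of_sq_eq_one ?_ ?_, exists_isHopfGaloisAction hreg hnorm⟩
    · rintro ⟨n, m, hm, c, hc, hn⟩
      refine Subtype.ext (Equiv.ext fun q => ?_)
      induction q using QuotientGroup.induction_on with | _ a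
      change n (n a) = a
      have hmm : m * m = 1 := e.injective <| by
        rw [map_mul, map_one]; exact hm.1
      rw [hn, hn, show m * (m * a * c) * c = m * m * a * (c * c) by group, hmm, one_mul]
      exact (QuotientGroup.mk_mul_of_mem a (mul_self_mem hB h3 hc))
    · rw [card_eq_finrank hreg, h]
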